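/- Let $k_1,k_2,k_3\in\mathbb Z_{\ge 0}$ and let $L=\mathbb Z[x_1^{\pm1},x_2^{\pm1},x_3^{\pm1}]$. Let $\mathcal A(k_1,k_2,k_3)$ be the generalized Markov cluster algebra: the generalized cluster algebra with trivial coefficients whose initial seed has cluster $(x_1,x_2,x_3)$, exchange polynomials $Z_i(u)=1+k_iu+u^2$ if $k_i\neq 0$ and $Z_i(u)=1+u$ if $k_i=0$, and exchange matrix $$B=\begin{bmatrix}0&-e_2&e_3\\ e_1&0&-e_3\\ -e_1&e_2&0\end{bmatrix},\qquad e_i=\begin{cases}2&k_i=0\\1&k_i\ne0.\end{cases}$$ A non-labeled cluster is a permutation of a labeled cluster. For a cluster variable $a$ let $k_a:=k_i$, where $i$ is the position of $a$ in a labeled cluster, and let $|a|:=a|_{x_1=x_2=x_3=1}$. Put $$\mathscr M=\frac{x_1^2+x_2^2+x_3^2+k_1x_2x_3+k_2x_1x_3+k_3x_1x_2}{x_1x_2x_3}.$$ A $(k_1,k_2,k_3)$-CMM (cluster Markov-monodromy) matrix is an $X\in SL(2,L)$ whose $(1,2)$-entry $x_{12}$ is a cluster variable of $\mathcal A(k_1,k_2,k_3)$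 and with $\mathrm{tr}(X)=-k_{x_{12}}$. A CMM triple associated with a non-labeled cluster $(a,b,c)$ is a triple $(X,Y,Z)$ of CMM matrices with $XYZ=\begin{bmatrix}-1&0\\ \mathscr M&-1\end{bmatrix}$ and $(x_{12},y_{12},z_{12})=(a,b,c)$. For $\sigma\in\mathfrak S_3$ and $f\in L$, write $(a,b,c)=(x_{\sigma(1)},x_{\sigma(2)},x_{\sigma(3)})$ and $(k_a,k_b,k_c)=(k_{\sigma(1)},k_{\sigma(2)},k_{\sigma(3)})$, and let $$X_\sigma(f)=\begin{bmatrix}f&a\\ *&-f-k_a\end{bmatrix},\quad Y_\sigma(f)=\begin{bmatrix}\frac{fb-k_ba-c}{a}&b\\ *&\frac{-fb+c}{a}\end{bmatrix},$$ $$Z_\sigma(f)=\begin{bmatrix}\frac{fbc-k_cab-k_bac-a^2-c^2}{ab}&c\\ *&\frac{-fbc+k_bac+a^2+c^2}{ab}\end{bmatrix},$$ where the $(2,1)$-entries are determined by the condition that the determinants are $1$. The inverse cluster Markov-monodromy tree $\mathrm{CMM}\mathbb T^\dag(k_1,k_2,k_3,\sigma,f)$ is the infinite binary tree with root $(X_\sigma(f),Y_\sigma(f),Z_\sigma(f))$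 in which each vertex $(X,Y,Z)$ has the left child $(X,Z,Z^{-1}YZ)$ and the right child $(XYX^{-1},X,Z)$. **Theorem.** Let $(X,Y,Z)$ be a $(k_1,k_2,k_3)$-CMM triple associated with $(a,b,c)$, and assume that $|b|\le\max\{|a|,|c|\}$. Then there exist a unique $f\in L$, a unique $\sigma\in\mathfrak S_3$ and a unique vertex $v$ of $\mathrm{CMM}\mathbb T^\dag(k_1,k_2,k_3,\sigma,f)$ such that $v=(X,Y,Z)$. -/

import Mathlib

open scoped MatrixGroups

namespace ClusterMM

noncomputable section

/-! ### Laurent polynomials in three variables -/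

/-- The ring `ℤ[x₁^±1, x₂^±1, x₃^±1]`, as the group ring over `ℤ` of the exponent lattice `ℤ³`.
The indices `0, 1, 2 : Fin 3` stand for `1, 2, 3`. -/
abbrev LaurentRing : Type := AddMonoidAlgebra ℤ (Fin 3 → ℤ)

/-- The ambient field `ℚ(x₁, x₂, x₃)` of the cluster algebra. -/
abbrev RatField : Type := FractionRing LaurentRing

/-- The variable `xᵢ`. -/
def x (i : Fin 3) : LaurentRing := AddMonoidAlgebra.single (Pi.single i 1) 1

/-- The Laurent monomial `xᵢ⁻¹`. -/
def xinv (i : Fin 3) : LaurentRing := AddMonoidAlgebra.single (Pi.single i (-1)) 1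

theorem x_mul_xinv (i : Fin 3) : x i * xinv i = 1 := by
  rw [x, xinv, AddMonoidAlgebra.single_mul_single, ← Pi.single_add]
  simp [AddMonoidAlgebra.one_def]

/-- The evaluation `|a| = a|_{x₁ = x₂ = x₃ = 1}`. -/
def evalOne : LaurentRing →ₐ[ℤ] ℤ := AddMonoidAlgebra.lift ℤ ℤ (Fin 3 → ℤ) 1

/-! ### Generalized seeds with trivial coefficients and their mutation -/

/-- The data of a labeled seed of a generalized cluster algebra of rank `n` with coefficients in
the trivial semifield `{1}` (so that the coefficient tuple is `(1, …, 1)`): the cluster, the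
exchange matrix and the exchange polynomials. -/
structure Seed (n : ℕ) (K : Type*) where
  cluster : Fin n → K
  B : Matrix (Fin n) (Fin n) ℤ
  Z : Fin n → Polynomial ℕ

/-- Seed mutation in direction `k`, where `d_k` is the degree of the exchange polynomial `Z_k`.
As the coefficient semifield is `{1}`, the factor `Z_k|_ℙ(y_k)` equals `1`. -/
def Seed.mutate {n : ℕ} {K : Type*} [Field K] (S : Seed n K) (k : Fin n) : Seed n K where
  cluster j :=
    if j = k then
      (S.cluster k)⁻¹ * (∏ i, S.cluster i ^ max (-S.B i k) 0) ^ (S.Z k).natDegree *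
        Polynomial.aeval (∏ i, S.cluster i ^ S.B i k) (S.Z k)
    else S.cluster j
  B := Matrix.of fun i j =>
    if i = k ∨ j = k then -S.B i j
    else S.B i j + ((S.Z k).natDegree : ℤ) *
      (max (S.B i k) 0 * S.B k j + S.B i k * max (-S.B k j) 0)
  Z j := if j = k then (S.Z k).reverse else S.Z j

/-! ### The generalized Markov cluster algebra `𝒜(k₁, k₂, k₃)` -/

/-- `2` if `κ = 0`, and `1` otherwise. -/
def colWeight (κ : ℕ) : ℤ := if κ = 0 then 2 else 1

/-- The exchange polynomial `1 + u` if `κ = 0`, and `1 + κ u + u²` otherwise. -/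
def exchangePoly (κ : ℕ) : Polynomial ℕ :=
  if κ = 0 then 1 + Polynomial.X
  else 1 + Polynomial.C κ * Polynomial.X + Polynomial.X ^ 2

/-- The initial seed of `𝒜(k₁, k₂, k₃)`, with cluster `(x₁, x₂, x₃)`. The `j`-th column of the
matrix with rows `(0, -1, 1), (1, 0, -1), (-1, 1, 0)` is doubled when `k_j = 0`. -/
def initialSeed (k : Fin 3 → ℕ) : Seed 3 RatField where
  cluster i := algebraMap LaurentRing RatField (x i)
  B := !![0, -colWeight (k 1), colWeight (k 2);
          colWeight (k 0), 0, -colWeight (k 2);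
          -colWeight (k 0), colWeight (k 1), 0]
  Z i := exchangePoly (k i)

/-- The labeled seeds of `𝒜(k₁, k₂, k₃)`: those obtained from the initial one by mutations. -/
inductive IsSeed (k : Fin 3 → ℕ) : Seed 3 RatField → Prop
  | init : IsSeed k (initialSeed k)
  | mutate (S : Seed 3 RatField) (i : Fin 3) : IsSeed k S → IsSeed k (S.mutate i)

/-- `a` is a cluster variable of `𝒜(k₁, k₂, k₃)` at the `i`-th position of some labeled cluster. -/
def IsClusterVariableAt (k : Fin 3 → ℕ) (i : Fin 3) (a : LaurentRing) : Prop :=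
  ∃ S, IsSeed k S ∧ S.cluster i = algebraMap LaurentRing RatField a

/-- `a` is a cluster variable of `𝒜(k₁, k₂, k₃)`. -/
def IsClusterVariable (k : Fin 3 → ℕ) (a : LaurentRing) : Prop :=
  ∃ i, IsClusterVariableAt k i a

/-- `κ` is the parity `k_a` of the cluster variable `a`: the number `k_i`, where `i` is the
position of `a` in a labeled cluster. -/
def HasParity (k : Fin 3 → ℕ) (a : LaurentRing) (κ : ℕ) : Prop :=
  ∃ i, IsClusterVariableAt k i a ∧ κ = k i

/-- `(a, b, c)` is a non-labeled cluster: a permutation of a labeled cluster. -/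
def IsNonlabeledCluster (k : Fin 3 → ℕ) (a b c : LaurentRing) : Prop :=
  ∃ S, IsSeed k S ∧ ∃ τ : Equiv.Perm (Fin 3),
    ∀ i, algebraMap LaurentRing RatField (![a, b, c] i) = S.cluster (τ i)

/-- The generalized Markov invariant
`(x₁² + x₂² + x₃² + k₁x₂x₃ + k₂x₁x₃ + k₃x₁x₂) / (x₁x₂x₃)`. -/
def markovInvariant (k : Fin 3 → ℕ) : LaurentRing :=
  (x 0 ^ 2 + x 1 ^ 2 + x 2 ^ 2 + k 0 * x 1 * x 2 + k 1 * x 0 * x 2 + k 2 * x 0 * x 1) *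
    (xinv 0 * xinv 1 * xinv 2)

/-! ### Cluster Markov-monodromy matrices and triples -/

/-- `SL(2, ℤ[x₁^±1, x₂^±1, x₃^±1])`. -/
abbrev SL2L : Type := SL(2, LaurentRing)

/-- `(k₁, k₂, k₃)`-cluster Markov-monodromy matrices. -/
structure IsCMMMatrix (k : Fin 3 → ℕ) (X : SL2L) : Prop where
  isClusterVariable : IsClusterVariable k (X 0 1)
  trace : ∃ κ, HasParity k (X 0 1) κ ∧ Matrix.trace (X : Matrix (Fin 2) (Fin 2) LaurentRing) = -κ

/-- `(k₁, k₂, k₃)`-cluster Markov-monodromy triples. -/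
structure IsCMMTriple (k : Fin 3 → ℕ) (X Y Z : SL2L) : Prop where
  left : IsCMMMatrix k X
  middle : IsCMMMatrix k Y
  right : IsCMMMatrix k Z
  prod : ((X * Y * Z : SL2L) : Matrix (Fin 2) (Fin 2) LaurentRing) =
    !![-1, 0; markovInvariant k, -1]
  cluster : IsNonlabeledCluster k (X 0 1) (Y 0 1) (Z 0 1)

/-- `(X, Y, Z)` is a CMM triple associated with the non-labeled cluster `(a, b, c)`. -/
def IsCMMTripleAssociated (k : Fin 3 → ℕ) (X Y Z : SL2L) (a b c : LaurentRing) : Prop :=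
  IsCMMTriple k X Y Z ∧ X 0 1 = a ∧ Y 0 1 = b ∧ Z 0 1 = c

/-! ### The inverse cluster Markov-monodromy trees -/

/-- The matrix of determinant `1` with diagonal entries `p, q` and `(1,2)`-entry `xᵢ`. Its
`(2,1)`-entry is determined by the determinant. -/
def diagMatrix (p q : LaurentRing) (i : Fin 3) : SL2L :=
  ⟨!![p, x i; (p * q - 1) * xinv i, q], by
    rw [Matrix.det_fin_two_of]
    linear_combination (1 - p * q) * x_mul_xinv i⟩

/-- The matrix `X_σ(f)`. -/
def Xσ (k : Fin 3 → ℕ) (σ : Equiv.Perm (Fin 3)) (f : LaurentRing) : SL2L :=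
  diagMatrix f (-f - k (σ 0)) (σ 0)

/-- The matrix `Y_σ(f)`. -/
def Yσ (k : Fin 3 → ℕ) (σ : Equiv.Perm (Fin 3)) (f : LaurentRing) : SL2L :=
  diagMatrix
    ((f * x (σ 1) - k (σ 1) * x (σ 0) - x (σ 2)) * xinv (σ 0))
    ((-f * x (σ 1) + x (σ 2)) * xinv (σ 0))
    (σ 1)

/-- The matrix `Z_σ(f)`. -/
def Zσ (k : Fin 3 → ℕ) (σ : Equiv.Perm (Fin 3)) (f : LaurentRing) : SL2L :=
  diagMatrix
    ((f * x (σ 1) * x (σ 2) - k (σ 2) * x (σ 0) * x (σ 1) - k (σ 1) * x (σ 0) * x (σ 2)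
      - x (σ 0) ^ 2 - x (σ 2) ^ 2) * (xinv (σ 0) * xinv (σ 1)))
    ((-f * x (σ 1) * x (σ 2) + k (σ 1) * x (σ 0) * x (σ 2)
      + x (σ 0) ^ 2 + x (σ 2) ^ 2) * (xinv (σ 0) * xinv (σ 1)))
    (σ 2)

/-- The left child of a vertex of the inverse tree. -/
def leftChild : SL2L × SL2L × SL2L → SL2L × SL2L × SL2L :=
  fun (X, Y, Z) => (X, Z, Z⁻¹ * Y * Z)

/-- The right child of a vertex of the inverse tree. -/
def rightChild : SL2L × SL2L × SL2L → SL2L × SL2L × SL2L :=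
  fun (X, Y, Z) => (X * Y * X⁻¹, X, Z)

/-- A vertex of the infinite binary tree: the word of left (`false`) and right (`true`) steps that
leads to it from the root, its last step first. -/
abbrev TreeVertex : Type := List Bool

/-- The triple at a vertex of the inverse `(k₁, k₂, k₃)`-cluster Markov-monodromy tree
`CMM𝕋†(k₁, k₂, k₃, σ, f)`, whose root is `(X_σ(f), Y_σ(f), Z_σ(f))`. -/
def inverseCMMTree (k : Fin 3 → ℕ) (σ : Equiv.Perm (Fin 3)) (f : LaurentRing) :
    TreeVertex → SL2L × SL2L × SL2L
  | [] => (Xσ k σ f, Yσ k σ f, Zσ k σ f)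
  | false :: v => leftChild (inverseCMMTree k σ f v)
  | true :: v => rightChild (inverseCMMTree k σ f v)

end

end ClusterMM

open ClusterMM

namespace ClusterMM

noncomputable section

/-! ### Evaluation at `(1, 1, 1)` -/

/-! Everything is governed by the (1,2)-entries. For a triple with the prescribed product and
traces, the determinant conditions give `IsMonodromyTriple.exchange`: the product of the middle
entry with the (1,2)-entry of `X * Z` is the exchange polynomial in the outer entries. So both child
moves act on the (1,2)-entries as cluster mutation of the middle one, and the inverse moves mutate
an outer one.

On clusters, mutation is a Vieta jump on the generalized Markov equation, which is why all clusters
stay in the Laurent ring. At (1, 1, 1) one gets positive integer solutions of a Markov-type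
equation. Existence is descent on these: if an outer value is the strict maximum, passing to the
corresponding parent lowers the sum (`vieta_le_max`). Otherwise the bound on the middle value makes
the maximum occur twice, so all values are 1 (`eq_one_of_markov`), the cluster is initial
(`Reach.eq_init`), and the triple is a root whose `f` is the (1,1)-entry of `X` (`eq_root`).

For uniqueness, the first and last values are equal at a root, while the first is smaller at a left
child and larger at a right child. Thus a triple determines its path, and the root determines `f`
and `σ` (`inverseCMMTree_injective`).

The trace condition mentions some position of a cluster variable. That this position is unique is
shown by a parity invariant of growth exponents (`Reach.position_unique`). -/

@[simp] theorem evalOne_x (i : Fin 3) : evalOne (x i) = 1 := by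
  simp [evalOne, x]

@[simp] theorem evalOne_xinv (i : Fin 3) : evalOne (xinv i) = 1 := by
  simp [evalOne, xinv]

@[simp] theorem evalOne_markovInvariant (k : Fin 3 → ℕ) :
    evalOne (markovInvariant k) = 3 + k 0 + k 1 + k 2 := by
  simp [markovInvariant]

theorem x_injective : Function.Injective x := by
  intro i j h
  have h1 : (Pi.single i 1 : Fin 3 → ℤ) = Pi.single j 1 :=
    AddMonoidAlgebra.single_left_injective one_ne_zero h
  by_contra hij
  have h2 := congrFun h1 i
  simp [Pi.single_eq_of_ne hij] at h2

/-! ### Vieta jumping for positive integers -/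

/-- If `b'` were also at most the maximum, `b * b'` would be at most the square of the maximum,
which is smaller than the right-hand side. -/
theorem max_lt_of_mul_eq {a b c b' : ℤ} {κ : ℕ} (ha : 0 < a) (hb : 0 < b) (hc : 0 < c)
    (h : b * b' = a ^ 2 + c ^ 2 + κ * a * c) (hle : b ≤ max a c) : max a c < b' := by
  have hκ : 0 ≤ (κ : ℤ) * a * c := by positivity
  have hb' : 0 < b' := by
    refine pos_of_mul_pos_right (a := b) ?_ hb.le
    rw [h]; positivity
  by_contra! hlt
  rcases le_total a c with hac | hac
  · rw [max_eq_right hac] at *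
    nlinarith
  · rw [max_eq_left hac] at *
    nlinarith

/-- The left side of the conclusion is the second root `a'` of the Markov equation as a quadratic in
`a`. At the larger of `b` and `c` this quadratic is nonpositive, so that point lies between the two
roots; being below `a`, it is at least `a'`. -/
theorem vieta_le_max {a b c : ℤ} {κ l m : ℕ} (hb : 0 < b) (hc : 0 < c)
    (h : a ^ 2 + b ^ 2 + c ^ 2 + κ * b * c + l * a * c + m * a * b = (3 + κ + l + m) * a * b * c)
    (hab : b < a) (hac : c < a) :
    (3 + κ + l + m) * b * c - l * c - m * b - a ≤ max b c := by
  have key : ∀ b c : ℤ, ∀ l m : ℕ, 0 < b → 0 < c → c ≤ b → b < a →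
      a ^ 2 + b ^ 2 + c ^ 2 + κ * b * c + l * a * c + m * a * b = (3 + κ + l + m) * a * b * c →
      (3 + κ + l + m) * b * c - l * c - m * b - a ≤ b := by
    intro b c l m hb hc hcb hab h
    by_contra! hlt
    have h1 : (b - a) * (b - ((3 + κ + l + m) * b * c - l * c - m * b - a)) =
        2 * b ^ 2 + c ^ 2 - 3 * (b ^ 2 * c) - κ * (b ^ 2 * c - b * c) - l * (b ^ 2 * c - b * c)
          - m * (b ^ 2 * c - b ^ 2) := by
      linear_combination -h
    have h2 : 0 < (b - a) * (b - ((3 + κ + l + m) * b * c - l * c - m * b - a)) :=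
      mul_pos_of_neg_of_neg (by linarith) (by linarith)
    have h3 : 0 ≤ b ^ 2 * c - b ^ 2 := by nlinarith [sq_nonneg b]
    have h4 : 0 ≤ b ^ 2 * c - b * c := by nlinarith [mul_pos hb hc]
    have h5 : 0 ≤ b ^ 2 * c - c ^ 2 := by nlinarith [mul_pos hb hc]
    have h6 := mul_nonneg (Int.natCast_nonneg κ) h4
    have h7 := mul_nonneg (Int.natCast_nonneg l) h4
    have h8 := mul_nonneg (Int.natCast_nonneg m) h3
    linarith
  rcases le_total c b with hcb | hcb
  · rw [max_eq_left hcb]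
    exact key b c l m hb hc hcb hab h
  · rw [max_eq_right hcb]
    have := key c b m l hc hb hcb hac (by linear_combination h)
    linear_combination this

/-- A positive solution of the Markov equation whose maximum `m` is attained twice is trivial. -/
theorem eq_one_of_markov {m n : ℤ} {κ l μ : ℕ} (hn : 0 < n) (hnm : n ≤ m)
    (h : 2 * m ^ 2 + n ^ 2 + κ * m ^ 2 + l * m * n + μ * m * n = (3 + κ + l + μ) * m ^ 2 * n) :
    m = 1 ∧ n = 1 := by
  have hm : 0 < m := by linarith
  have h1 : 0 ≤ m ^ 2 * n - m ^ 2 := by nlinarith [sq_nonneg m]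
  have h2 : 0 ≤ m ^ 2 * n - m * n := by nlinarith [mul_pos hm hn]
  have h3 : m ≤ 1 := by
    by_contra! hlt
    -- The right side minus the left side of `h` is a sum of nonnegative terms; this one is strictly
    -- positive once `m > 1`.
    have h5 : 0 < m ^ 2 * n - n ^ 2 := by nlinarith [mul_pos hm hn]
    have h6 := mul_nonneg (Int.natCast_nonneg κ) h1
    have h7 := mul_nonneg (Int.natCast_nonneg l) h2
    have h8 := mul_nonneg (Int.natCast_nonneg μ) h2
    nlinarith
  omega

/-! ### Clusters in the Laurent polynomial ring -/

/-- The generalized Markov equation. -/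
def MarkovEq (k : Fin 3 → ℕ) (C : Fin 3 → LaurentRing) : Prop :=
  C 0 ^ 2 + C 1 ^ 2 + C 2 ^ 2 + k 0 * C 1 * C 2 + k 1 * C 0 * C 2 + k 2 * C 0 * C 1 =
    markovInvariant k * C 0 * C 1 * C 2

theorem markovEq_x (k : Fin 3 → ℕ) : MarkovEq k x := by
  have h0 := x_mul_xinv 0
  have h1 := x_mul_xinv 1
  have h2 := x_mul_xinv 2
  have h : x 0 * x 1 * x 2 * (xinv 0 * xinv 1 * xinv 2) = 1 := by
    calc _ = (x 0 * xinv 0) * (x 1 * xinv 1) * (x 2 * xinv 2) := by ring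
      _ = 1 := by rw [h0, h1, h2]; ring
  unfold MarkovEq markovInvariant
  linear_combination (-(x 0 ^ 2 + x 1 ^ 2 + x 2 ^ 2 + k 0 * x 1 * x 2 + k 1 * x 0 * x 2 +
    k 2 * x 0 * x 1)) * h

theorem MarkovEq.perm {k : Fin 3 → ℕ} {C : Fin 3 → LaurentRing} (h : MarkovEq k C)
    {i j l : Fin 3} (hij : i ≠ j) (hil : i ≠ l) (hjl : j ≠ l) :
    C i ^ 2 + C j ^ 2 + C l ^ 2 + k i * C j * C l + k j * C i * C l + k l * C i * C j =
      markovInvariant k * C i * C j * C l := by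
  unfold MarkovEq at h
  fin_cases i <;> fin_cases j <;> fin_cases l <;> first | contradiction | skip
  all_goals
    simp only [Fin.zero_eta, Fin.mk_one, Fin.reduceFinMk]
    linear_combination h

/-- Mutation of a solution of the Markov equation, as a Vieta jump. -/
def mutateCluster (k : Fin 3 → ℕ) (i : Fin 3) (C : Fin 3 → LaurentRing) : Fin 3 → LaurentRing :=
  Function.update C i (markovInvariant k * C (i + 1) * C (i + 2) - k (i + 1) * C (i + 2)
    - k (i + 2) * C (i + 1) - C i)

theorem mutateCluster_of_ne (k : Fin 3 → ℕ) {i j : Fin 3} (h : j ≠ i) (C : Fin 3 → LaurentRing) :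
    mutateCluster k i C j = C j :=
  Function.update_of_ne h _ _

theorem mutateCluster_self (k : Fin 3 → ℕ) {i j l : Fin 3} (hij : i ≠ j) (hil : i ≠ l)
    (hjl : j ≠ l) (C : Fin 3 → LaurentRing) :
    mutateCluster k i C i = markovInvariant k * C j * C l - k j * C l - k l * C j - C i := by
  rw [mutateCluster, Function.update_self]
  fin_cases i <;> fin_cases j <;> fin_cases l <;> first | contradiction | skip
  all_goals
    simp only [Fin.zero_eta, Fin.mk_one, Fin.reduceFinMk, Fin.reduceAdd, zero_add] <;> ring

theorem MarkovEq.mul_mutateCluster {k : Fin 3 → ℕ} {C : Fin 3 → LaurentRing} (h : MarkovEq k C)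
    {i j l : Fin 3} (hij : i ≠ j) (hil : i ≠ l) (hjl : j ≠ l) :
    C i * mutateCluster k i C i = C j ^ 2 + C l ^ 2 + k i * C j * C l := by
  rw [mutateCluster_self k hij hil hjl]
  linear_combination -h.perm hij hil hjl

theorem exists_others (i : Fin 3) : ∃ j l : Fin 3, i ≠ j ∧ i ≠ l ∧ j ≠ l := by
  revert i; decide

theorem eq_or_eq_of_ne {i j l n : Fin 3} (hij : i ≠ j) (hil : i ≠ l) (hjl : j ≠ l) (hn : n ≠ i) :
    n = j ∨ n = l := by
  revert i j l n; decide

theorem mutateCluster_mutateCluster (k : Fin 3 → ℕ) (i : Fin 3) (C : Fin 3 → LaurentRing) :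
    mutateCluster k i (mutateCluster k i C) = C := by
  obtain ⟨j, l, hij, hil, hjl⟩ := exists_others i
  funext n
  by_cases hn : n = i
  · subst hn
    rw [mutateCluster_self k hij hil hjl, mutateCluster_self k hij hil hjl,
      mutateCluster_of_ne k hij.symm, mutateCluster_of_ne k hil.symm]
    ring
  · rw [mutateCluster_of_ne k hn, mutateCluster_of_ne k hn]

theorem MarkovEq.mutateCluster {k : Fin 3 → ℕ} {C : Fin 3 → LaurentRing} (h : MarkovEq k C)
    (i : Fin 3) : MarkovEq k (mutateCluster k i C) := by
  unfold MarkovEq at *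
  fin_cases i
  all_goals
    simp only [ClusterMM.mutateCluster, Fin.zero_eta, Fin.mk_one, Fin.reduceFinMk, Fin.reduceAdd,
      zero_add]
    simp
    linear_combination h

/-- The clusters obtained from the initial one by mutations that increase the value at
`(1, 1, 1)`. -/
inductive Reach (k : Fin 3 → ℕ) : (Fin 3 → LaurentRing) → Prop
  | init : Reach k x
  | mutate (C : Fin 3 → LaurentRing) (i j l : Fin 3) (hij : i ≠ j) (hil : i ≠ l) (hjl : j ≠ l) :
      Reach k C → evalOne (C i) ≤ max (evalOne (C j)) (evalOne (C l)) →
      Reach k (mutateCluster k i C)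

theorem Reach.markovEq {k : Fin 3 → ℕ} {C : Fin 3 → LaurentRing} (h : Reach k C) :
    MarkovEq k C := by
  induction h with
  | init => exact markovEq_x k
  | mutate C i j l _ _ _ _ _ ih => exact ih.mutateCluster i

theorem Reach.evalOne_pos {k : Fin 3 → ℕ} {C : Fin 3 → LaurentRing} (h : Reach k C) (i : Fin 3) :
    0 < evalOne (C i) := by
  induction h generalizing i with
  | init => simp
  | mutate C n j l hij hil hjl hC _ ih =>
    by_cases hi : i = n
    · subst hi
      have h1 := congrArg evalOne (hC.markovEq.mul_mutateCluster hij hil hjl)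
      simp only [map_mul, map_add, map_pow, map_natCast] at h1
      refine pos_of_mul_pos_right (a := evalOne (C i)) ?_ (ih i).le
      rw [h1]
      have := ih j
      have := ih l
      positivity
    · rw [mutateCluster_of_ne k hi]
      exact ih i

theorem Reach.ne_zero {k : Fin 3 → ℕ} {C : Fin 3 → LaurentRing} (h : Reach k C) (i : Fin 3) :
    C i ≠ 0 := by
  intro h0
  have := h.evalOne_pos i
  simp [h0] at this

theorem MarkovEq.evalOne_perm {k : Fin 3 → ℕ} {C : Fin 3 → LaurentRing} (h : MarkovEq k C)
    {i j l : Fin 3} (hij : i ≠ j) (hil : i ≠ l) (hjl : j ≠ l) :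
    evalOne (C i) ^ 2 + evalOne (C j) ^ 2 + evalOne (C l) ^ 2 + k i * evalOne (C j) * evalOne (C l)
      + k j * evalOne (C i) * evalOne (C l) + k l * evalOne (C i) * evalOne (C j) =
      (3 + k i + k j + k l) * evalOne (C i) * evalOne (C j) * evalOne (C l) := by
  have h1 := congrArg evalOne (h.perm hij hil hjl)
  simp only [map_mul, map_add, map_pow, map_natCast, evalOne_markovInvariant] at h1
  rw [h1]
  fin_cases i <;> fin_cases j <;> fin_cases l <;> first | contradiction | skip
  all_goals
    simp only [Fin.zero_eta, Fin.mk_one, Fin.reduceFinMk] <;> ring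

theorem evalOne_mutateCluster_self (k : Fin 3 → ℕ) {i j l : Fin 3} (hij : i ≠ j) (hil : i ≠ l)
    (hjl : j ≠ l) (C : Fin 3 → LaurentRing) :
    evalOne (mutateCluster k i C i) = (3 + k i + k j + k l) * evalOne (C j) * evalOne (C l)
      - k j * evalOne (C l) - k l * evalOne (C j) - evalOne (C i) := by
  rw [mutateCluster_self k hij hil hjl]
  simp only [map_mul, map_sub, map_natCast, evalOne_markovInvariant]
  fin_cases i <;> fin_cases j <;> fin_cases l <;> first | contradiction | skip
  all_goals
    simp only [Fin.zero_eta, Fin.mk_one, Fin.reduceFinMk] <;> ring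

theorem Reach.max_lt {k : Fin 3 → ℕ} {C : Fin 3 → LaurentRing} (h : Reach k C)
    {i j l : Fin 3} (hij : i ≠ j) (hil : i ≠ l) (hjl : j ≠ l)
    (hle : evalOne (C i) ≤ max (evalOne (C j)) (evalOne (C l))) :
    max (evalOne (C j)) (evalOne (C l)) < evalOne (mutateCluster k i C i) := by
  have h1 := congrArg evalOne (h.markovEq.mul_mutateCluster hij hil hjl)
  simp only [map_mul, map_add, map_pow, map_natCast] at h1
  exact max_lt_of_mul_eq (h.evalOne_pos j) (h.evalOne_pos i) (h.evalOne_pos l) h1 hle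

/-- Mutation is an involution, so the last increasing mutation can be undone, and it has put the
strict maximum at its own position. -/
theorem Reach.eq_init_or_exists {k : Fin 3 → ℕ} {C : Fin 3 → LaurentRing} (h : Reach k C) :
    C = x ∨ ∃ i, Reach k (mutateCluster k i C) ∧ ∀ n ≠ i, evalOne (C n) < evalOne (C i) := by
  cases h with
  | init => exact Or.inl rfl
  | mutate C i j l hij hil hjl hC hle =>
    refine Or.inr ⟨i, by rwa [mutateCluster_mutateCluster], fun n hn => ?_⟩
    rw [mutateCluster_of_ne k hn]
    refine lt_of_le_of_lt ?_ (hC.max_lt hij hil hjl hle)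
    have : n = j ∨ n = l := eq_or_eq_of_ne hij hil hjl hn
    rcases this with rfl | rfl
    · exact le_max_left _ _
    · exact le_max_right _ _

/-- The set of reachable clusters is closed under all mutations. -/
theorem Reach.mutateCluster {k : Fin 3 → ℕ} {C : Fin 3 → LaurentRing} (h : Reach k C)
    (i : Fin 3) : Reach k (mutateCluster k i C) := by
  obtain ⟨j, l, hij, hil, hjl⟩ := exists_others i
  by_cases hle : evalOne (C i) ≤ max (evalOne (C j)) (evalOne (C l))
  · exact .mutate C i j l hij hil hjl h hle
  · push Not at hle
    obtain ⟨h1, h2⟩ := max_lt_iff.1 hle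
    rcases h.eq_init_or_exists with rfl | ⟨n, hn, hmax⟩
    · simp at h1
    -- A decreasing mutation takes place at the strict maximum, which is unique, so it undoes the
    -- last increasing one.
    · have : n = i := by
        by_contra hne
        have h3 := hmax i (Ne.symm hne)
        have : n = j ∨ n = l := eq_or_eq_of_ne hij hil hjl hne
        rcases this with rfl | rfl <;> linarith
      exact this ▸ hn

theorem Reach.eq_init {k : Fin 3 → ℕ} {C : Fin 3 → LaurentRing} (h : Reach k C)
    (h1 : ∀ i, evalOne (C i) = 1) : C = x := by
  rcases h.eq_init_or_exists with h | ⟨i, -, hmax⟩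
  · exact h
  · obtain ⟨j, -, hij, -, -⟩ := exists_others i
    have := hmax j hij.symm
    rw [h1, h1] at this
    exact absurd this (lt_irrefl _)

/-! ### Labeled seeds -/

theorem exchangePoly_natDegree_zero : (exchangePoly 0).natDegree = 1 := by
  unfold exchangePoly
  rw [if_pos rfl]
  compute_degree!

theorem exchangePoly_natDegree {κ : ℕ} (h : κ ≠ 0) : (exchangePoly κ).natDegree = 2 := by
  unfold exchangePoly
  rw [if_neg h]
  compute_degree!

/-- Doubling the column compensates for the lower degree when `κ = 0`; hence both cases obey the
same exchange relation. -/
theorem exchangePoly_natDegree_mul_colWeight (κ : ℕ) :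
    ((exchangePoly κ).natDegree : ℤ) * colWeight κ = 2 := by
  by_cases h : κ = 0
  · subst h
    rw [exchangePoly_natDegree_zero]
    simp [colWeight]
  · rw [exchangePoly_natDegree h]
    simp [colWeight, h]

theorem colWeight_pos (κ : ℕ) : 0 < colWeight κ := by
  unfold colWeight
  split_ifs <;> norm_num

/-- The polynomials are palindromic, so mutation never changes them. -/
theorem exchangePoly_reverse (κ : ℕ) : (exchangePoly κ).reverse = exchangePoly κ := by
  ext n
  rw [Polynomial.coeff_reverse]
  by_cases h : κ = 0
  · subst h
    rw [exchangePoly_natDegree_zero]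
    rcases n with _ | _ | n
    · rw [Polynomial.revAt_le (by norm_num)]
      simp [exchangePoly, Polynomial.coeff_one, Polynomial.coeff_X]
    · rw [Polynomial.revAt_le (by norm_num)]
      simp [exchangePoly, Polynomial.coeff_one, Polynomial.coeff_X]
    · rw [Polynomial.revAt_eq_self_of_lt (by omega)]
  · rw [exchangePoly_natDegree h]
    rcases n with _ | _ | _ | n
    · rw [Polynomial.revAt_le (by norm_num)]
      simp [exchangePoly, h, Polynomial.coeff_one, Polynomial.coeff_X]
    · rw [Polynomial.revAt_le (by norm_num)]
    · rw [Polynomial.revAt_le (by norm_num)]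
      simp [exchangePoly, h, Polynomial.coeff_one, Polynomial.coeff_X]
    · rw [Polynomial.revAt_eq_self_of_lt (by omega)]

theorem exchange_eq {K : Type*} [Field K] (κ : ℕ) {u v : K} (hu : u ≠ 0) :
    (u ^ colWeight κ) ^ (exchangePoly κ).natDegree *
      Polynomial.aeval (v ^ colWeight κ * u ^ (-colWeight κ)) (exchangePoly κ) =
      u ^ 2 + v ^ 2 + κ * u * v := by
  by_cases h : κ = 0
  · subst h
    rw [exchangePoly_natDegree_zero]
    simp only [exchangePoly, colWeight, if_true, map_add, map_one, Polynomial.aeval_X, zpow_neg,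
      zpow_ofNat, pow_one, Nat.cast_zero]
    field_simp
    ring
  · rw [exchangePoly_natDegree h]
    simp only [exchangePoly, colWeight, if_neg h, map_add, map_one, Polynomial.aeval_X, zpow_neg,
      zpow_one, map_mul, map_pow, eq_natCast, map_natCast]
    field_simp
    ring

/-- The labeled seed `S` has the cluster `C`, consisting of Laurent polynomials. -/
structure SeedOf (k : Fin 3 → ℕ) (S : Seed 3 RatField) (C : Fin 3 → LaurentRing) : Prop where
  cluster : ∀ i, S.cluster i = algebraMap LaurentRing RatField (C i)
  B : S.B = (initialSeed k).B ∨ S.B = -(initialSeed k).B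
  Z : ∀ i, S.Z i = exchangePoly (k i)

/-- Off the mutated row and column, a diagonal correction vanishes by sign skew-symmetry. For an
off-diagonal one, the degree times the column weight is 2, so the correction is `-2` times the old
entry. -/
theorem mutate_B (k : Fin 3 → ℕ) (S : Seed 3 RatField)
    (hB : S.B = (initialSeed k).B ∨ S.B = -(initialSeed k).B)
    (hZ : ∀ i, S.Z i = exchangePoly (k i)) (i : Fin 3) : (S.mutate i).B = -S.B := by
  have h := exchangePoly_natDegree_mul_colWeight
  have hp := fun j => (colWeight_pos (k j)).le
  ext m n
  simp only [Seed.mutate, Matrix.of_apply, Matrix.neg_apply]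
  rw [hZ]
  split_ifs with hmn
  · rfl
  · push Not at hmn
    rcases hB with hB | hB
    all_goals
      rw [hB]
      simp only [initialSeed]
      fin_cases i <;> fin_cases m <;> fin_cases n <;> simp_all
      all_goals grind

theorem mutate_cluster_self (k : Fin 3 → ℕ) (S : Seed 3 RatField)
    (hB : S.B = (initialSeed k).B ∨ S.B = -(initialSeed k).B)
    (hZ : ∀ i, S.Z i = exchangePoly (k i)) (h0 : ∀ i, S.cluster i ≠ 0)
    {i j l : Fin 3} (hij : i ≠ j) (hil : i ≠ l) (hjl : j ≠ l) :
    (S.mutate i).cluster i = (S.cluster i)⁻¹ *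
      (S.cluster j ^ 2 + S.cluster l ^ 2 + k i * S.cluster j * S.cluster l) := by
  have hp := fun j => (colWeight_pos (k j)).le
  -- The sign of `B` and the cyclic order of the indices decide which of `j`, `l` carries the
  -- negative exponent, and their numerical order decides the order of the factors; hence four
  -- variants.
  have h1 := exchange_eq (k i) (v := S.cluster l) (h0 j)
  have h2 := exchange_eq (k i) (v := S.cluster j) (h0 l)
  have h3 : S.cluster l ^ 2 + S.cluster j ^ 2 + k i * S.cluster l * S.cluster j =
    S.cluster j ^ 2 + S.cluster l ^ 2 + k i * S.cluster j * S.cluster l := by ring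
  rw [h3] at h2
  have h1' := h1
  have h2' := h2
  rw [mul_comm (_ ^ colWeight _) (_ ^ (-colWeight _))] at h1' h2'
  simp only [Seed.mutate, if_true]
  rw [hZ, mul_assoc]
  congr 1
  rcases hB with hB | hB
  all_goals
    rw [hB]
    simp only [initialSeed, Fin.prod_univ_three]
    fin_cases i <;> fin_cases j <;> fin_cases l <;> first | contradiction | skip
    all_goals
      simp [hp] at h1 h2 h1' h2' ⊢
      first | exact h1 | exact h2 | exact h1' | exact h2'

/-- The Markov equation exhibits the exchange quotient as a Laurent polynomial, namely the Vieta
partner, so no general Laurent phenomenon is needed. -/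
theorem SeedOf.mutate {k : Fin 3 → ℕ} {S : Seed 3 RatField} {C : Fin 3 → LaurentRing}
    (h : SeedOf k S C) (hC : Reach k C) (i : Fin 3) :
    SeedOf k (S.mutate i) (mutateCluster k i C) where
  cluster n := by
    by_cases hn : n = i
    · subst hn
      obtain ⟨j, l, hij, hil, hjl⟩ := exists_others n
      have h0 : ∀ m, S.cluster m ≠ 0 := fun m => by
        rw [h.cluster]
        simpa using hC.ne_zero m
      rw [mutate_cluster_self k S h.B h.Z h0 hij hil hjl, inv_mul_eq_iff_eq_mul₀ (h0 n),
        h.cluster, h.cluster, h.cluster, ← map_mul, hC.markovEq.mul_mutateCluster hij hil hjl]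
      simp
    · rw [mutateCluster_of_ne k hn, ← h.cluster]
      simp [Seed.mutate, hn]
  B := by
    rw [mutate_B k S h.B h.Z]
    rcases h.B with hB | hB <;> simp [hB]
  Z n := by
    simp only [Seed.mutate]
    split_ifs with hn
    · rw [h.Z, exchangePoly_reverse, hn]
    · exact h.Z n

theorem IsSeed.exists_reach {k : Fin 3 → ℕ} {S : Seed 3 RatField} (h : IsSeed k S) :
    ∃ C, Reach k C ∧ SeedOf k S C := by
  induction h with
  | init => exact ⟨x, .init, fun _ => rfl, Or.inl rfl, fun _ => rfl⟩
  | mutate S i _ ih =>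
    obtain ⟨C, hC, hS⟩ := ih
    exact ⟨mutateCluster k i C, hC.mutateCluster i, hS.mutate hC i⟩

theorem algebraMap_ratField_injective : Function.Injective (algebraMap LaurentRing RatField) :=
  IsFractionRing.injective LaurentRing RatField

theorem IsClusterVariableAt.exists_reach {k : Fin 3 → ℕ} {i : Fin 3} {a : LaurentRing}
    (h : IsClusterVariableAt k i a) : ∃ C, Reach k C ∧ C i = a := by
  obtain ⟨S, hS, ha⟩ := h
  obtain ⟨C, hC, hSC⟩ := hS.exists_reach
  exact ⟨C, hC, algebraMap_ratField_injective (by rw [← hSC.cluster, ha])⟩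

/-! ### Growth exponents of cluster variables -/

/-- The evaluation at `x_l = exp s`, with the other two variables set to `1`. -/
def evalExp (l : Fin 3) (s : ℝ) : LaurentRing →ₐ[ℤ] ℝ :=
  AddMonoidAlgebra.lift ℤ ℝ (Fin 3 → ℤ)
    { toFun := fun v => Real.exp (Multiplicative.toAdd v l * s)
      map_one' := by simp
      map_mul' := fun v w => by
        rw [← Real.exp_add, toAdd_mul, Pi.add_apply]
        push_cast
        ring_nf }

theorem evalExp_x (l i : Fin 3) (s : ℝ) :
    evalExp l s (x i) = Real.exp (((if i = l then 1 else 0 : ℤ) : ℝ) * s) := by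
  simp [evalExp, x, Pi.single_apply, eq_comm]

/-- The function `s ↦ evalExp l s a` grows as `exp (d * s)`. -/
def HasGrowth (l : Fin 3) (a : LaurentRing) (d : ℤ) : Prop :=
  ∃ p q : ℝ, 0 < p ∧ 0 < q ∧ ∀ s, 0 ≤ s →
    p * Real.exp (d * s) ≤ evalExp l s a ∧ evalExp l s a ≤ q * Real.exp (d * s)

theorem hasGrowth_x (l i : Fin 3) : HasGrowth l (x i) (if i = l then 1 else 0) :=
  ⟨1, 1, one_pos, one_pos, fun s _ => by rw [evalExp_x, one_mul]; exact ⟨le_rfl, le_rfl⟩⟩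

theorem HasGrowth.le {l : Fin 3} {a : LaurentRing} {d d' : ℤ} (h : HasGrowth l a d)
    (h' : HasGrowth l a d') : d' ≤ d := by
  by_contra! hlt
  obtain ⟨_, q, _, hq, H⟩ := h
  obtain ⟨p, _, hp, _, H'⟩ := h'
  -- At `s = q / p`, the two bounds would force `exp s ≤ q / p = s`.
  have hs : 0 ≤ q / p := by positivity
  have h1 := ((H' _ hs).1).trans (H _ hs).2
  have h2 : Real.exp (d * (q / p)) * Real.exp (q / p) ≤ Real.exp (d' * (q / p)) := by
    rw [← Real.exp_add]
    refine Real.exp_le_exp.2 ?_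
    have : (d : ℝ) + 1 ≤ d' := by exact_mod_cast hlt
    nlinarith
  have h3 : q / p < Real.exp (q / p) := by linarith [Real.add_one_le_exp (q / p)]
  have h4 : q < p * Real.exp (q / p) := by
    rw [div_lt_iff₀ hp] at h3
    linarith
  have h5 := Real.exp_pos (d * (q / p))
  nlinarith

theorem HasGrowth.unique {l : Fin 3} {a : LaurentRing} {d d' : ℤ} (h : HasGrowth l a d)
    (h' : HasGrowth l a d') : d = d' :=
  le_antisymm (h'.le h) (h.le h')

/-- All terms are positive, so nothing cancels: `c ^ 2` alone gives the lower bound, and every term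
is bounded by a multiple of `exp (2 * dc * s)`. -/
theorem HasGrowth.exchange_of_le {l : Fin 3} {a a' b c : LaurentRing} {da db dc : ℤ} {κ : ℕ}
    (ha : HasGrowth l a da) (hb : HasGrowth l b db) (hc : HasGrowth l c dc)
    (h : a * a' = b ^ 2 + c ^ 2 + κ * b * c) (hle : db ≤ dc) :
    HasGrowth l a' (2 * dc - da) := by
  obtain ⟨pa, qa, hpa, hqa, Ha⟩ := ha
  obtain ⟨pb, qb, hpb, hqb, Hb⟩ := hb
  obtain ⟨pc, qc, hpc, hqc, Hc⟩ := hc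
  refine ⟨pc ^ 2 / qa, (qb ^ 2 + qc ^ 2 + κ * qb * qc) / pa, by positivity, by positivity,
    fun s hs => ?_⟩
  obtain ⟨ha1, ha2⟩ := Ha s hs
  obtain ⟨hb1, hb2⟩ := Hb s hs
  obtain ⟨hc1, hc2⟩ := Hc s hs
  have h1 := congrArg (evalExp l s) h
  simp only [map_mul, map_add, map_pow, map_natCast] at h1
  set A := evalExp l s a
  set A' := evalExp l s a'
  set b := evalExp l s b
  set c := evalExp l s c
  have hE : Real.exp ((2 * dc - da : ℤ) * s) = Real.exp (dc * s) ^ 2 / Real.exp (da * s) := by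
    rw [← Real.exp_nat_mul, ← Real.exp_sub]
    push_cast
    ring_nf
  have hD : Real.exp (db * s) ≤ Real.exp (dc * s) := by
    refine Real.exp_le_exp.2 (mul_le_mul_of_nonneg_right ?_ hs)
    exact_mod_cast hle
  rw [hE]
  have hF := Real.exp_pos (da * s)
  have hG := Real.exp_pos (db * s)
  have hH := Real.exp_pos (dc * s)
  set E := Real.exp (dc * s)
  set F := Real.exp (da * s)
  set G := Real.exp (db * s)
  have hA : 0 < A := lt_of_lt_of_le (by positivity) ha1
  have hb0 : 0 < b := lt_of_lt_of_le (by positivity) hb1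
  have hc0 : 0 < c := lt_of_lt_of_le (by positivity) hc1
  have hbE : b ≤ qb * E := hb2.trans (by gcongr)
  have hA' : A' = (b ^ 2 + c ^ 2 + κ * b * c) / A := by
    rw [eq_div_iff hA.ne', ← h1, mul_comm]
  rw [hA']
  constructor
  · calc pc ^ 2 / qa * (E ^ 2 / F) = (pc * E) ^ 2 / (qa * F) := by
          rw [mul_pow, div_mul_div_comm]
      _ ≤ c ^ 2 / A := by gcongr
      _ ≤ _ := by
          gcongr
          have : 0 ≤ b ^ 2 + κ * b * c := by positivity
          linarith
  · calc (b ^ 2 + c ^ 2 + κ * b * c) / A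
        ≤ ((qb * E) ^ 2 + (qc * E) ^ 2 + κ * (qb * E) * (qc * E)) / (pa * F) := by gcongr
      _ = _ := by rw [div_mul_div_comm]; ring_nf

theorem HasGrowth.exchange {l : Fin 3} {a a' b c : LaurentRing} {da db dc : ℤ} {κ : ℕ}
    (ha : HasGrowth l a da) (hb : HasGrowth l b db) (hc : HasGrowth l c dc)
    (h : a * a' = b ^ 2 + c ^ 2 + κ * b * c) :
    HasGrowth l a' (2 * max db dc - da) := by
  rcases le_total db dc with hle | hle
  · rw [max_eq_right hle]
    exact ha.exchange_of_le hb hc h hle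
  · rw [max_eq_left hle]
    exact ha.exchange_of_le (κ := κ) hc hb (by rw [h]; ring) hle

/-- The growth exponent of a cluster variable at position `i` is congruent to `δ_{il}` modulo
`2`. -/
theorem Reach.exists_hasGrowth {k : Fin 3 → ℕ} {C : Fin 3 → LaurentRing} (h : Reach k C)
    (l i : Fin 3) : ∃ d : ℤ, HasGrowth l (C i) (2 * d + if i = l then 1 else 0) := by
  induction h generalizing i with
  | init => exact ⟨0, by simpa using hasGrowth_x l i⟩
  | mutate C n j m hnj hnm hjm hC _ ih =>
    by_cases hi : i = n
    · subst hi
      obtain ⟨d, hd⟩ := ih i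
      obtain ⟨d₁, hd₁⟩ := ih j
      obtain ⟨d₂, hd₂⟩ := ih m
      have := hd.exchange hd₁ hd₂ (hC.markovEq.mul_mutateCluster hnj hnm hjm)
      -- With `δ` the indicator of `i = l`, this is `2 * max - (2 * d + δ) = 2 * (max - d - δ) + δ`.
      refine ⟨max (2 * d₁ + if j = l then 1 else 0) (2 * d₂ + if m = l then 1 else 0) - d -
        if i = l then 1 else 0, ?_⟩
      convert this using 1
      ring
    · rw [mutateCluster_of_ne k hi]
      exact ih i

/-- A cluster variable determines its position in the labeled clusters that contain it. -/
theorem Reach.position_unique {k : Fin 3 → ℕ} {C C' : Fin 3 → LaurentRing} (h : Reach k C)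
    (h' : Reach k C') {i j : Fin 3} (hij : C i = C' j) : i = j := by
  -- In the direction `i` the exponent is odd at position `i` and even at every other position.
  obtain ⟨d, hd⟩ := h.exists_hasGrowth i i
  obtain ⟨d', hd'⟩ := h'.exists_hasGrowth i j
  rw [hij] at hd
  have := hd.unique hd'
  by_contra hne
  rw [if_pos rfl, if_neg (Ne.symm hne)] at this
  omega

/-! ### Triples of matrices with the monodromy of a CMM triple -/

/-- The determinant, trace and product conditions on a CMM triple. -/
structure IsMonodromyTriple (k : Fin 3 → ℕ) (κ l m : ℕ) (X Y Z : SL2L) : Prop where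
  trace_left : X 0 0 + X 1 1 = -κ
  trace_middle : Y 0 0 + Y 1 1 = -l
  trace_right : Z 0 0 + Z 1 1 = -m
  prod : ((X * Y * Z : SL2L) : Matrix (Fin 2) (Fin 2) LaurentRing) =
    !![-1, 0; markovInvariant k, -1]

theorem SL2L.det_eq (X : SL2L) : X 0 0 * X 1 1 - X 0 1 * X 1 0 = 1 := by
  rw [← Matrix.det_fin_two]
  exact X.det_coe

theorem SL2L.mul_apply (X Y : SL2L) (i j : Fin 2) :
    (X * Y) i j = X i 0 * Y 0 j + X i 1 * Y 1 j := by
  simp [Matrix.mul_apply, Fin.sum_univ_two]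

theorem SL2L.trace_conj (X Y : SL2L) :
    (X * Y * X⁻¹) 0 0 + (X * Y * X⁻¹) 1 1 = Y 0 0 + Y 1 1 := by
  have h := SL2L.det_eq X
  simp only [SL2L.mul_apply, Matrix.SpecialLinearGroup.coe_inv, Matrix.adjugate_fin_two]
  simp
  linear_combination (Y 0 0 + Y 1 1) * h

theorem SL2L.trace_conj' (X Y : SL2L) :
    (X⁻¹ * Y * X) 0 0 + (X⁻¹ * Y * X) 1 1 = Y 0 0 + Y 1 1 := by
  simpa using SL2L.trace_conj X⁻¹ Y

section

variable {k : Fin 3 → ℕ} {κ l m : ℕ} {X Y Z : SL2L}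

namespace IsMonodromyTriple

theorem leftChild (h : IsMonodromyTriple k κ l m X Y Z) :
    IsMonodromyTriple k κ m l X Z (Z⁻¹ * Y * Z) where
  trace_left := h.trace_left
  trace_middle := h.trace_right
  trace_right := by rw [SL2L.trace_conj', h.trace_middle]
  prod := by
    have h1 : X * Z * (Z⁻¹ * Y * Z) = X * Y * Z := by group
    rw [h1, h.prod]

theorem rightChild (h : IsMonodromyTriple k κ l m X Y Z) :
    IsMonodromyTriple k l κ m (X * Y * X⁻¹) X Z where
  trace_left := by rw [SL2L.trace_conj, h.trace_middle]
  trace_middle := h.trace_left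
  trace_right := h.trace_right
  prod := by
    have h1 : X * Y * X⁻¹ * X * Z = X * Y * Z := by group
    rw [h1, h.prod]

/-- The parent of a left child. -/
theorem leftParent (h : IsMonodromyTriple k κ l m X Y Z) :
    IsMonodromyTriple k κ m l X (Y * Z * Y⁻¹) Y where
  trace_left := h.trace_left
  trace_middle := by rw [SL2L.trace_conj, h.trace_right]
  trace_right := h.trace_middle
  prod := by
    have h1 : X * (Y * Z * Y⁻¹) * Y = X * Y * Z := by group
    rw [h1, h.prod]

/-- The parent of a right child. -/
theorem rightParent (h : IsMonodromyTriple k κ l m X Y Z) :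
    IsMonodromyTriple k l κ m Y (Y⁻¹ * X * Y) Z where
  trace_left := h.trace_middle
  trace_middle := by rw [SL2L.trace_conj', h.trace_left]
  trace_right := h.trace_right
  prod := by
    have h1 : Y * (Y⁻¹ * X * Y) * Z = X * Y * Z := by group
    rw [h1, h.prod]

theorem mul_eq (h : IsMonodromyTriple k κ l m X Y Z) :
    ((X * Y : SL2L) : Matrix (Fin 2) (Fin 2) LaurentRing) =
      !![-Z 1 1, Z 0 1; markovInvariant k * Z 1 1 + Z 1 0, -(markovInvariant k * Z 0 1) - Z 0 0] := by
  have h1 : X * Y = X * Y * Z * Z⁻¹ := by group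
  rw [h1, Matrix.SpecialLinearGroup.coe_mul, h.prod, Matrix.SpecialLinearGroup.coe_inv,
    Matrix.adjugate_fin_two]
  ext i j
  fin_cases i <;> fin_cases j <;> simp [Matrix.mul_apply, Fin.sum_univ_two, sub_eq_add_neg]

theorem eq₀₀ (h : IsMonodromyTriple k κ l m X Y Z) :
    X 0 0 * Y 0 0 + X 0 1 * Y 1 0 = -Z 1 1 := by
  rw [← SL2L.mul_apply]
  exact congrFun (congrFun h.mul_eq 0) 0

theorem eq₀₁ (h : IsMonodromyTriple k κ l m X Y Z) :
    X 0 0 * Y 0 1 + X 0 1 * Y 1 1 = Z 0 1 := by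
  rw [← SL2L.mul_apply]
  exact congrFun (congrFun h.mul_eq 0) 1

theorem mul_Z₁₁ (h : IsMonodromyTriple k κ l m X Y Z) :
    Y 0 1 * Z 1 1 = X 0 1 - Y 0 0 * Z 0 1 := by
  linear_combination Y 0 1 * h.eq₀₀ - Y 0 0 * h.eq₀₁ + X 0 1 * SL2L.det_eq Y

/-- The new `(1,2)`-entry of both children is the mutation of the `(1,2)`-entry of `Y`. -/
theorem exchange (h : IsMonodromyTriple k κ l m X Y Z) :
    Y 0 1 * (X * Z) 0 1 = X 0 1 ^ 2 + Z 0 1 ^ 2 + l * X 0 1 * Z 0 1 := by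
  rw [SL2L.mul_apply]
  linear_combination Z 0 1 * h.eq₀₁ + X 0 1 * h.mul_Z₁₁ - X 0 1 * Z 0 1 * h.trace_middle

/-- Up to the inverse of `X * Z`, the conjugate is the lower triangular product `X * Y * Z`, whose
diagonal is `-1`; the two signs cancel. -/
theorem leftChild_apply (h : IsMonodromyTriple k κ l m X Y Z) :
    (Z⁻¹ * Y * Z) 0 1 = (X * Z) 0 1 := by
  have h1 : Z⁻¹ * Y * Z = (X * Z)⁻¹ * (X * Y * Z) := by group
  rw [h1, SL2L.mul_apply, h.prod, Matrix.SpecialLinearGroup.coe_inv, Matrix.adjugate_fin_two]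
  simp

theorem rightChild_apply (h : IsMonodromyTriple k κ l m X Y Z) :
    (X * Y * X⁻¹) 0 1 = (X * Z) 0 1 := by
  have h1 : X * Y * X⁻¹ = (X * Y * Z) * (X * Z)⁻¹ := by group
  rw [h1, SL2L.mul_apply, h.prod, Matrix.SpecialLinearGroup.coe_inv, Matrix.adjugate_fin_two]
  simp

end IsMonodromyTriple

/-- The hypotheses give three entries of `X * Y`, with the Markov equation entering only in the
(2,2)-entry; determinants supply the rest. Denominators are cleared by cancelling the nonzero `a`,
`b`, `c`. -/
theorem IsMonodromyTriple.of_markov {a b c : LaurentRing} (hX : X 0 1 = a) (hY : Y 0 1 = b)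
    (hZ : Z 0 1 = c) (ha : a ≠ 0) (hb : b ≠ 0) (hc : c ≠ 0)
    (hm : a ^ 2 + b ^ 2 + c ^ 2 + κ * b * c + l * a * c + m * a * b =
      markovInvariant k * a * b * c)
    (t1 : X 0 0 + X 1 1 = -κ) (t2 : Y 0 0 + Y 1 1 = -l) (t3 : Z 0 0 + Z 1 1 = -m)
    (e1 : X 0 0 * b + a * Y 1 1 = c) (e2 : b * Z 1 1 = a - Y 0 0 * c) :
    IsMonodromyTriple k κ l m X Y Z := by
  refine ⟨t1, t2, t3, ?_⟩
  have dX := SL2L.det_eq X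
  have dY := SL2L.det_eq Y
  have dZ := SL2L.det_eq Z
  have dXY := SL2L.det_eq (X * Y)
  have h01 : (X * Y) 0 1 = c := by
    rw [SL2L.mul_apply, hX, hY]
    exact e1
  have h00 : (X * Y) 0 0 = -Z 1 1 := by
    rw [SL2L.mul_apply, hX]
    rw [hY] at dY
    refine mul_left_cancel₀ hb ?_
    linear_combination Y 0 0 * e1 + e2 - a * dY
  have h11 : (X * Y) 1 1 = -(markovInvariant k * c) - Z 0 0 := by
    rw [SL2L.mul_apply, hY]
    rw [hX] at dX
    refine mul_left_cancel₀ (mul_ne_zero ha hb) ?_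
    linear_combination -b ^ 2 * dX + b * X 1 1 * e1 + a * b * t3 - a * e2 - c * e1 + b * c * t1
      + a * c * t2 - hm
  rw [h00, h01, h11] at dXY
  rw [hZ] at dZ
  have h10 : (X * Y) 1 0 * Z 0 0 + (X * Y) 1 1 * Z 1 0 = markovInvariant k := by
    rw [h11]
    refine mul_left_cancel₀ hc ?_
    linear_combination -Z 0 0 * dXY + (markovInvariant k * c + Z 0 0) * dZ
  apply Matrix.ext
  intro i j
  rw [SL2L.mul_apply (X * Y) Z]
  fin_cases i <;> fin_cases j
  · change (X * Y) 0 0 * Z 0 0 + (X * Y) 0 1 * Z 1 0 = -1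
    rw [h00, h01]
    linear_combination -dZ
  · change (X * Y) 0 0 * Z 0 1 + (X * Y) 0 1 * Z 1 1 = 0
    rw [h00, h01, hZ]
    ring
  · exact h10
  · change (X * Y) 1 0 * Z 0 1 + (X * Y) 1 1 * Z 1 1 = -1
    rw [h11, hZ]
    linear_combination -dXY

/-! ### Vertices of the inverse tree -/

theorem diagMatrix_eq {X : SL2L} {i : Fin 3} (h : X 0 1 = x i) :
    X = diagMatrix (X 0 0) (X 1 1) i := by
  have h1 := SL2L.det_eq X
  rw [h] at h1
  apply Matrix.SpecialLinearGroup.ext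
  intro n j
  fin_cases n <;> fin_cases j
  · rfl
  · exact h
  · change X 1 0 = (X 0 0 * X 1 1 - 1) * xinv i
    linear_combination -xinv i * h1 - X 1 0 * x_mul_xinv i
  · rfl

/-- Over the initial cluster the (1,2)-entries are units, so once `X 0 0` is known, the traces and
two entries of the product relation can be solved for all the other diagonal entries. -/
theorem eq_root {σ : Equiv.Perm (Fin 3)}
    (h : IsMonodromyTriple k (k (σ 0)) (k (σ 1)) (k (σ 2)) X Y Z) (hX : X 0 1 = x (σ 0))
    (hY : Y 0 1 = x (σ 1)) (hZ : Z 0 1 = x (σ 2)) :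
    inverseCMMTree k σ (X 0 0) [] = (X, Y, Z) := by
  have hx0 := x_mul_xinv (σ 0)
  have hx1 := x_mul_xinv (σ 1)
  have e1 := h.eq₀₁
  have e2 := h.mul_Z₁₁
  have t1 := h.trace_left
  have t2 := h.trace_middle
  have t3 := h.trace_right
  rw [hX, hY, hZ] at e1
  rw [hX, hY, hZ] at e2
  have hX11 : X 1 1 = -X 0 0 - k (σ 0) := by linear_combination t1
  have hY11 : Y 1 1 = (-X 0 0 * x (σ 1) + x (σ 2)) * xinv (σ 0) := by
    linear_combination -Y 1 1 * hx0 + xinv (σ 0) * e1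
  have hY00 : Y 0 0 = (X 0 0 * x (σ 1) - k (σ 1) * x (σ 0) - x (σ 2)) * xinv (σ 0) := by
    linear_combination t2 - hY11 + k (σ 1) * hx0
  have hZ11 : Z 1 1 = (-X 0 0 * x (σ 1) * x (σ 2) + k (σ 1) * x (σ 0) * x (σ 2)
      + x (σ 0) ^ 2 + x (σ 2) ^ 2) * (xinv (σ 0) * xinv (σ 1)) := by
    linear_combination -Z 1 1 * hx1 + xinv (σ 1) * e2 - x (σ 2) * xinv (σ 1) * hY00 -
      x (σ 0) * xinv (σ 1) * hx0
  have hZ00 : Z 0 0 = (X 0 0 * x (σ 1) * x (σ 2) - k (σ 2) * x (σ 0) * x (σ 1)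
      - k (σ 1) * x (σ 0) * x (σ 2) - x (σ 0) ^ 2 - x (σ 2) ^ 2) * (xinv (σ 0) * xinv (σ 1)) := by
    linear_combination t3 - hZ11 + k (σ 2) * hx1 + k (σ 2) * x (σ 1) * xinv (σ 1) * hx0
  have h1 : Xσ k σ (X 0 0) = X := by rw [Xσ, ← hX11, ← diagMatrix_eq hX]
  have h2 : Yσ k σ (X 0 0) = Y := by rw [Yσ, ← hY11, ← hY00, ← diagMatrix_eq hY]
  have h3 : Zσ k σ (X 0 0) = Z := by rw [Zσ, ← hZ11, ← hZ00, ← diagMatrix_eq hZ]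
  rw [inverseCMMTree, h1, h2, h3]

/-- This starts the induction that gives every vertex of every tree the exchange relation, as
uniqueness requires. -/
theorem isMonodromyTriple_root (k : Fin 3 → ℕ) (σ : Equiv.Perm (Fin 3)) (f : LaurentRing) :
    IsMonodromyTriple k (k (σ 0)) (k (σ 1)) (k (σ 2)) (Xσ k σ f) (Yσ k σ f) (Zσ k σ f) := by
  have hx0 := x_mul_xinv (σ 0)
  have hx1 := x_mul_xinv (σ 1)
  have hm := (markovEq_x k).perm (i := σ 0) (j := σ 1) (l := σ 2) (by simp) (by simp) (by simp)
  have h0 : ∀ i, x i ≠ 0 := fun i h => by simpa [h] using evalOne_x i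
  have e0 : Xσ k σ f 0 0 = f := rfl
  have y0 : Yσ k σ f 0 0 = (f * x (σ 1) - k (σ 1) * x (σ 0) - x (σ 2)) * xinv (σ 0) := rfl
  have y1 : Yσ k σ f 1 1 = (-f * x (σ 1) + x (σ 2)) * xinv (σ 0) := rfl
  have z0 : Zσ k σ f 0 0 = (f * x (σ 1) * x (σ 2) - k (σ 2) * x (σ 0) * x (σ 1)
    - k (σ 1) * x (σ 0) * x (σ 2) - x (σ 0) ^ 2 - x (σ 2) ^ 2) * (xinv (σ 0) * xinv (σ 1)) := rfl
  have z1 : Zσ k σ f 1 1 = (-f * x (σ 1) * x (σ 2) + k (σ 1) * x (σ 0) * x (σ 2)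
    + x (σ 0) ^ 2 + x (σ 2) ^ 2) * (xinv (σ 0) * xinv (σ 1)) := rfl
  refine .of_markov (a := x (σ 0)) (b := x (σ 1)) (c := x (σ 2)) rfl rfl rfl (h0 _) (h0 _) (h0 _)
    hm ?_ ?_ ?_ ?_ ?_
  · change f + (-f - k (σ 0)) = -(k (σ 0) : LaurentRing)
    ring
  · rw [y0, y1]
    linear_combination -k (σ 1) * hx0
  · rw [z0, z1]
    linear_combination -k (σ 2) * hx1 - k (σ 2) * x (σ 1) * xinv (σ 1) * hx0
  · rw [e0, y1]
    linear_combination (x (σ 2) - f * x (σ 1)) * hx0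
  · rw [z1, y0]
    linear_combination (-f * x (σ 1) * x (σ 2) + k (σ 1) * x (σ 0) * x (σ 2)
      + x (σ 0) ^ 2 + x (σ 2) ^ 2) * xinv (σ 0) * hx1 + x (σ 0) * hx0

/-- A vertex of the inverse tree, with the positivity and maximality properties of the values of
its `(1,2)`-entries at `(1, 1, 1)`. -/
structure IsPositiveVertex (k : Fin 3 → ℕ) (κ l m : ℕ) (X Y Z : SL2L) : Prop
    extends IsMonodromyTriple k κ l m X Y Z where
  pos_left : 0 < evalOne (X 0 1)
  pos_middle : 0 < evalOne (Y 0 1)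
  pos_right : 0 < evalOne (Z 0 1)
  middle_le : evalOne (Y 0 1) ≤ max (evalOne (X 0 1)) (evalOne (Z 0 1))

namespace IsPositiveVertex

theorem max_lt (h : IsPositiveVertex k κ l m X Y Z) :
    max (evalOne (X 0 1)) (evalOne (Z 0 1)) < evalOne ((X * Z) 0 1) := by
  have h1 := congrArg evalOne h.exchange
  simp only [map_mul, map_add, map_pow, map_natCast] at h1
  exact max_lt_of_mul_eq h.pos_left h.pos_middle h.pos_right h1 h.middle_le

theorem leftChild (h : IsPositiveVertex k κ l m X Y Z) :
    IsPositiveVertex k κ m l X Z (Z⁻¹ * Y * Z) where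
  toIsMonodromyTriple := h.toIsMonodromyTriple.leftChild
  pos_left := h.pos_left
  pos_middle := h.pos_right
  pos_right := by
    rw [h.leftChild_apply]
    exact (h.pos_left.trans_le (le_max_left _ _)).trans h.max_lt
  middle_le := by
    rw [h.leftChild_apply]
    exact ((le_max_right _ _).trans h.max_lt.le).trans (le_max_right _ _)

theorem rightChild (h : IsPositiveVertex k κ l m X Y Z) :
    IsPositiveVertex k l κ m (X * Y * X⁻¹) X Z where
  toIsMonodromyTriple := h.toIsMonodromyTriple.rightChild
  pos_left := by
    rw [h.rightChild_apply]
    exact (h.pos_left.trans_le (le_max_left _ _)).trans h.max_lt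
  pos_middle := h.pos_left
  pos_right := h.pos_right
  middle_le := by
    rw [h.rightChild_apply]
    exact ((le_max_left _ _).trans h.max_lt.le).trans (le_max_left _ _)

end IsPositiveVertex

end

theorem exists_isPositiveVertex (k : Fin 3 → ℕ) (σ : Equiv.Perm (Fin 3)) (f : LaurentRing)
    (v : TreeVertex) : ∃ κ l m, IsPositiveVertex k κ l m (inverseCMMTree k σ f v).1
      (inverseCMMTree k σ f v).2.1 (inverseCMMTree k σ f v).2.2 := by
  induction v with
  | nil =>
    refine ⟨_, _, _, isMonodromyTriple_root k σ f, ?_, ?_, ?_, ?_⟩ <;>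
      simp [inverseCMMTree, Xσ, Yσ, Zσ, diagMatrix]
  | cons d v ih =>
    obtain ⟨κ, l, m, h⟩ := ih
    cases d
    · exact ⟨_, _, _, h.leftChild⟩
    · exact ⟨_, _, _, h.rightChild⟩

/-- The values at `(1, 1, 1)` of the `(1,2)`-entries of a triple. -/
def entryValue (T : SL2L × SL2L × SL2L) : ℤ × ℤ × ℤ :=
  (evalOne (T.1 0 1), evalOne (T.2.1 0 1), evalOne (T.2.2 0 1))

theorem entryValue_root (k : Fin 3 → ℕ) (σ : Equiv.Perm (Fin 3)) (f : LaurentRing) :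
    entryValue (inverseCMMTree k σ f []) = (1, 1, 1) := by
  simp [entryValue, inverseCMMTree, Xσ, Yσ, Zσ, diagMatrix]

theorem entryValue_left (k : Fin 3 → ℕ) (σ : Equiv.Perm (Fin 3)) (f : LaurentRing)
    (v : TreeVertex) : (entryValue (inverseCMMTree k σ f (false :: v))).1 <
      (entryValue (inverseCMMTree k σ f (false :: v))).2.2 := by
  obtain ⟨κ, l, m, h⟩ := exists_isPositiveVertex k σ f v
  have h1 := (le_max_left _ _).trans_lt h.max_lt
  rw [← h.leftChild_apply] at h1
  exact h1

theorem entryValue_right (k : Fin 3 → ℕ) (σ : Equiv.Perm (Fin 3)) (f : LaurentRing)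
    (v : TreeVertex) : (entryValue (inverseCMMTree k σ f (true :: v))).2.2 <
      (entryValue (inverseCMMTree k σ f (true :: v))).1 := by
  obtain ⟨κ, l, m, h⟩ := exists_isPositiveVertex k σ f v
  have h1 := (le_max_right _ _).trans_lt h.max_lt
  rw [← h.rightChild_apply] at h1
  exact h1

theorem leftChild_injective : Function.Injective leftChild := by
  rintro ⟨X, Y, Z⟩ ⟨X', Y', Z'⟩ h
  simp only [leftChild, Prod.mk.injEq] at h
  obtain ⟨rfl, rfl, h⟩ := h
  simpa using h

theorem rightChild_injective : Function.Injective rightChild := by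
  rintro ⟨X, Y, Z⟩ ⟨X', Y', Z'⟩ h
  simp only [rightChild, Prod.mk.injEq] at h
  obtain ⟨h, rfl, rfl⟩ := h
  simpa using h

theorem root_injective {k : Fin 3 → ℕ} {σ σ' : Equiv.Perm (Fin 3)} {f f' : LaurentRing}
    (h : inverseCMMTree k σ f [] = inverseCMMTree k σ' f' []) : f = f' ∧ σ = σ' := by
  simp only [inverseCMMTree, Prod.mk.injEq] at h
  obtain ⟨h1, h2, h3⟩ := h
  have e0 : x (σ 0) = x (σ' 0) := congrArg (fun X : SL2L => X 0 1) h1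
  have e1 : x (σ 1) = x (σ' 1) := congrArg (fun X : SL2L => X 0 1) h2
  have e2 : x (σ 2) = x (σ' 2) := congrArg (fun X : SL2L => X 0 1) h3
  refine ⟨congrArg (fun X : SL2L => X 0 0) h1, Equiv.ext fun i => ?_⟩
  fin_cases i
  · exact x_injective e0
  · exact x_injective e1
  · exact x_injective e2

/-- Comparing the first and last entry values tells a root, a left child and a right child apart;
the child maps are injective, so the paths can be peeled off step by step. -/
theorem inverseCMMTree_injective {k : Fin 3 → ℕ} {σ σ' : Equiv.Perm (Fin 3)}
    {f f' : LaurentRing} {v v' : TreeVertex}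
    (h : inverseCMMTree k σ f v = inverseCMMTree k σ' f' v') : f = f' ∧ σ = σ' ∧ v = v' := by
  induction v generalizing v' with
  | nil =>
    match v' with
    | [] => simpa using root_injective h
    | false :: v' =>
      have h1 := entryValue_left k σ' f' v'
      rw [← h, entryValue_root] at h1
      exact absurd h1 (lt_irrefl _)
    | true :: v' =>
      have h1 := entryValue_right k σ' f' v'
      rw [← h, entryValue_root] at h1
      exact absurd h1 (lt_irrefl _)
  | cons d v ih =>
    match d, v' with
    | false, [] =>
      have h1 := entryValue_left k σ f v
      rw [h, entryValue_root] at h1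
      exact absurd h1 (lt_irrefl _)
    | true, [] =>
      have h1 := entryValue_right k σ f v
      rw [h, entryValue_root] at h1
      exact absurd h1 (lt_irrefl _)
    | false, false :: v' =>
      obtain ⟨rfl, rfl, rfl⟩ := ih (leftChild_injective h)
      exact ⟨rfl, rfl, rfl⟩
    | true, true :: v' =>
      obtain ⟨rfl, rfl, rfl⟩ := ih (rightChild_injective h)
      exact ⟨rfl, rfl, rfl⟩
    | false, true :: v' =>
      have h1 := entryValue_left k σ f v
      rw [h] at h1
      exact absurd h1 (entryValue_right k σ' f' v').not_gt
    | true, false :: v' =>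
      have h1 := entryValue_right k σ f v
      rw [h] at h1
      exact absurd h1 (entryValue_left k σ' f' v').not_gt

/-! ### Descent -/

/-- A triple with the monodromy of a CMM triple whose `(1,2)`-entries form the reachable cluster
`C`, permuted by `τ`. -/
structure IsClusterTriple (k : Fin 3 → ℕ) (C : Fin 3 → LaurentRing) (τ : Equiv.Perm (Fin 3))
    (X Y Z : SL2L) : Prop
    extends IsMonodromyTriple k (k (τ 0)) (k (τ 1)) (k (τ 2)) X Y Z where
  reach : Reach k C
  left : X 0 1 = C (τ 0)
  middle : Y 0 1 = C (τ 1)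
  right : Z 0 1 = C (τ 2)

namespace IsClusterTriple

variable {k : Fin 3 → ℕ} {C : Fin 3 → LaurentRing} {τ : Equiv.Perm (Fin 3)} {X Y Z : SL2L}

/-- The given triple is the right child of its parent, so `X 0 1` is the new entry in the parent's
exchange relation. Cancelling it identifies the parent's middle entry with the Vieta partner. -/
theorem rightParent (h : IsClusterTriple k C τ X Y Z) :
    IsClusterTriple k (mutateCluster k (τ 0) C) (τ * Equiv.swap 0 1) Y (Y⁻¹ * X * Y) Z := by
  have e0 : (τ * Equiv.swap 0 1 : Equiv.Perm (Fin 3)) 0 = τ 1 := by simp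
  have e1 : (τ * Equiv.swap 0 1 : Equiv.Perm (Fin 3)) 1 = τ 0 := by simp
  have e2 : (τ * Equiv.swap 0 1 : Equiv.Perm (Fin 3)) 2 = τ 2 := congrArg τ (by decide)
  have hp := h.toIsMonodromyTriple.rightParent
  refine ⟨by rw [e0, e1, e2]; exact hp, h.reach.mutateCluster _, ?_, ?_, ?_⟩
  · rw [e0, mutateCluster_of_ne k (by simp), h.middle]
  · rw [e1]
    refine mul_left_cancel₀ (h.reach.ne_zero (τ 0)) ?_
    rw [h.reach.markovEq.mul_mutateCluster (i := τ 0) (j := τ 1) (l := τ 2)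
      (by simp) (by simp) (by simp)]
    have h1 := hp.exchange
    have h2 : Y * (Y⁻¹ * X * Y) * Y⁻¹ = X := by group
    rw [← hp.rightChild_apply, h2, h.left, h.middle, h.right] at h1
    rw [mul_comm, h1]
  · rw [e2, mutateCluster_of_ne k (by simp), h.right]

theorem leftParent (h : IsClusterTriple k C τ X Y Z) :
    IsClusterTriple k (mutateCluster k (τ 2) C) (τ * Equiv.swap 1 2) X (Y * Z * Y⁻¹) Y := by
  have e0 : (τ * Equiv.swap 1 2 : Equiv.Perm (Fin 3)) 0 = τ 0 := congrArg τ (by decide)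
  have e1 : (τ * Equiv.swap 1 2 : Equiv.Perm (Fin 3)) 1 = τ 2 := by simp
  have e2 : (τ * Equiv.swap 1 2 : Equiv.Perm (Fin 3)) 2 = τ 1 := by simp
  have hp := h.toIsMonodromyTriple.leftParent
  refine ⟨by rw [e0, e1, e2]; exact hp, h.reach.mutateCluster _, ?_, ?_, ?_⟩
  · rw [e0, mutateCluster_of_ne k (by simp), h.left]
  · rw [e1]
    refine mul_left_cancel₀ (h.reach.ne_zero (τ 2)) ?_
    rw [h.reach.markovEq.mul_mutateCluster (i := τ 2) (j := τ 0) (l := τ 1)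
      (by simp) (by simp) (by simp)]
    have h1 := hp.exchange
    have h2 : Y⁻¹ * (Y * Z * Y⁻¹) * Y = Z := by group
    rw [← hp.leftChild_apply, h2, h.left, h.middle, h.right] at h1
    rw [mul_comm, h1]
  · rw [e2, mutateCluster_of_ne k (by simp), h.middle]

theorem exists_vertex (h : IsClusterTriple k C τ X Y Z)
    (hle : evalOne (Y 0 1) ≤ max (evalOne (X 0 1)) (evalOne (Z 0 1))) :
    ∃ f σ v, inverseCMMTree k σ f v = (X, Y, Z) := by
  -- Induction on a bound for the sum of the three values; the bound 0 contradicts positivity.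
  obtain ⟨n, hn⟩ : ∃ n : ℕ, evalOne (X 0 1) + evalOne (Y 0 1) + evalOne (Z 0 1) ≤ n :=
    ⟨_, Int.self_le_toNat _⟩
  induction n generalizing C τ X Y Z with
  | zero =>
    rw [h.left, h.middle, h.right] at hn
    have h0 := h.reach.evalOne_pos (τ 0)
    have h1 := h.reach.evalOne_pos (τ 1)
    have h2 := h.reach.evalOne_pos (τ 2)
    push_cast at hn
    omega
  | succ n ih =>
    have h0 := h.reach.evalOne_pos (τ 0)
    have h1 := h.reach.evalOne_pos (τ 1)
    have h2 := h.reach.evalOne_pos (τ 2)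
    have hm := h.reach.markovEq.evalOne_perm (i := τ 0) (j := τ 1) (l := τ 2)
      (by simp) (by simp) (by simp)
    have hX := congrArg evalOne h.left
    have hY := congrArg evalOne h.middle
    have hZ := congrArg evalOne h.right
    rw [← hX] at h0 hm
    rw [← hY] at h1 hm
    rw [← hZ] at h2 hm
    set A := evalOne (X 0 1)
    set B := evalOne (Y 0 1)
    set D := evalOne (Z 0 1)
    push_cast at hn
    -- A strict maximum on the left marks a right child, one on the right marks a left child. The
    -- Vieta bound also restores the condition on the middle value for the parent.
    by_cases hA : B < A ∧ D < A
    · have hp := h.rightParent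
      have hnew := congrArg evalOne hp.middle
      rw [Equiv.Perm.mul_apply, Equiv.swap_apply_right, evalOne_mutateCluster_self k (i := τ 0)
        (j := τ 1) (l := τ 2) (by simp) (by simp) (by simp), ← hX, ← hY, ← hZ] at hnew
      have hmax := vieta_le_max h1 h2 hm hA.1 hA.2
      rw [← hnew] at hmax
      have hlt := hmax.trans_lt (max_lt hA.1 hA.2)
      obtain ⟨f, σ, v, hv⟩ := ih hp hmax (by omega)
      refine ⟨f, σ, true :: v, ?_⟩
      have h2 : Y * (Y⁻¹ * X * Y) * Y⁻¹ = X := by group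
      rw [inverseCMMTree, hv, rightChild, h2]
    by_cases hD : B < D ∧ A < D
    · have hp := h.leftParent
      have hnew := congrArg evalOne hp.middle
      rw [Equiv.Perm.mul_apply, Equiv.swap_apply_left, evalOne_mutateCluster_self k (i := τ 2)
        (j := τ 0) (l := τ 1) (by simp) (by simp) (by simp), ← hX, ← hY, ← hZ] at hnew
      have hmax := vieta_le_max (a := D) (b := A) (c := B) (κ := k (τ 2)) (l := k (τ 0))
        (m := k (τ 1)) h0 h1 (by linear_combination hm) hD.2 hD.1
      rw [← hnew] at hmax
      have hlt := hmax.trans_lt (max_lt hD.2 hD.1)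
      obtain ⟨f, σ, v, hv⟩ := ih hp hmax (by omega)
      refine ⟨f, σ, false :: v, ?_⟩
      have h2 : Y⁻¹ * (Y * Z * Y⁻¹) * Y = Z := by group
      rw [inverseCMMTree, hv, leftChild, h2]
    -- No outer value is a strict maximum and `B` does not exceed both, so the maximum is attained
    -- twice.
    have hone : A = 1 ∧ B = 1 ∧ D = 1 := by
      rcases lt_trichotomy A D with hAD | hAD | hAD
      · have hBD : B = D := by rw [max_eq_right hAD.le] at hle; omega
        rw [hBD] at hm
        obtain ⟨e1, e2⟩ := eq_one_of_markov (m := D) (n := A) (κ := k (τ 0)) (l := k (τ 1))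
          (μ := k (τ 2)) h0 hAD.le (by linear_combination hm)
        omega
      · rw [hAD, max_self] at hle
        rw [hAD] at hm
        obtain ⟨e1, e2⟩ := eq_one_of_markov (m := D) (n := B) (κ := k (τ 1)) (l := k (τ 0))
          (μ := k (τ 2)) h1 hle (by linear_combination hm)
        omega
      · have hBA : B = A := by rw [max_eq_left hAD.le] at hle; omega
        rw [hBA] at hm
        obtain ⟨e1, e2⟩ := eq_one_of_markov (m := A) (n := D) (κ := k (τ 2)) (l := k (τ 0))
          (μ := k (τ 1)) h2 hAD.le (by linear_combination hm)
        omega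
    have hC : C = x := by
      refine h.reach.eq_init fun i => ?_
      obtain ⟨j, rfl⟩ := τ.surjective i
      fin_cases j
      · exact hX.symm.trans hone.1
      · exact hY.symm.trans hone.2.1
      · exact hZ.symm.trans hone.2.2
    subst hC
    exact ⟨_, _, _, eq_root h.toIsMonodromyTriple h.left h.middle h.right⟩

end IsClusterTriple

/-- `HasParity` allows any position at which the variable occurs; uniqueness of the position removes
the choice. -/
theorem HasParity.eq {k : Fin 3 → ℕ} {C : Fin 3 → LaurentRing} (hC : Reach k C) {i : Fin 3}
    {a : LaurentRing} {κ : ℕ} (ha : a = C i) (h : HasParity k a κ) : κ = k i := by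
  obtain ⟨j, hj, rfl⟩ := h
  obtain ⟨C', hC', hj'⟩ := hj.exists_reach
  rw [hC.position_unique hC' (ha.symm.trans hj'.symm)]

theorem IsCMMTriple.exists_isClusterTriple {k : Fin 3 → ℕ} {X Y Z : SL2L}
    (h : IsCMMTriple k X Y Z) : ∃ C τ, IsClusterTriple k C τ X Y Z := by
  obtain ⟨S, hS, τ, hτ⟩ := h.cluster
  obtain ⟨C, hC, hSC⟩ := hS.exists_reach
  have key : ∀ i, ![X 0 1, Y 0 1, Z 0 1] i = C (τ i) := fun i =>
    algebraMap_ratField_injective (by rw [hτ, hSC.cluster])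
  have trace : ∀ {W : SL2L} {i : Fin 3}, IsCMMMatrix k W → W 0 1 = C i →
      W 0 0 + W 1 1 = -(k i : LaurentRing) := by
    intro W i hW hi
    obtain ⟨κ, hκ, ht⟩ := hW.trace
    rw [← hκ.eq hC hi, ← ht, Matrix.trace_fin_two]
  exact ⟨C, τ, ⟨trace h.left (key 0), trace h.middle (key 1), trace h.right (key 2), h.prod⟩,
    hC, key 0, key 1, key 2⟩

end

end ClusterMM

theorem mainTheorem7 (k : Fin 3 → ℕ) (X Y Z : SL2L) (a b c : LaurentRing)
    (h : IsCMMTripleAssociated k X Y Z a b c)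
    (hb : evalOne b ≤ max (evalOne a) (evalOne c)) :
    ∃! p : LaurentRing × Equiv.Perm (Fin 3) × TreeVertex,
      inverseCMMTree k p.2.1 p.1 p.2.2 = (X, Y, Z) := by
  obtain ⟨h, rfl, rfl, rfl⟩ := h
  obtain ⟨C, τ, hT⟩ := h.exists_isClusterTriple
  obtain ⟨f, σ, v, hv⟩ := hT.exists_vertex hb
  refine ⟨(f, σ, v), hv, ?_⟩
  rintro ⟨f', σ', v'⟩ hv'
  obtain ⟨rfl, rfl, rfl⟩ := inverseCMMTree_injective (hv'.trans hv.symm)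
  rfl
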